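/- Let $\mathcal A$ and $\mathcal B$ be finite-dimensional unital $C^*$-algebras, let $\omega:\mathcal A\to\mathbb C$ be a state (a positive unital linear functional), let $F:\mathcal B\to\mathcal A$ be a completely positive unital (CPU) linear map, and set $\xi:=\omega\circ F$. Terminology. For a state $\varphi$ on a $C^*$-algebra $\mathcal C$, two linear maps $H,K:\mathcal D\to\mathcal C$ are *$\varphi$-a.e. equivalent* if $\varphi(H(d)c)=\varphi(K(d)c)$ and $\varphi(cH(d))=\varphi(cK(d))$ for all $c\in\mathcal C$, $d\in\mathcal D$. The map $F$ is *$\omega$-a.e. deterministic* if $\omega(F(b)F(b')a)=\omega(F(bb')a)$ and $\omega(aF(b)F(b'))=\omega(aF(bb'))$ for all $a\in\mathcal A$, $b,b'\in\mathcal B$. A CPU map $G:\mathcal A\to\mathcal B$ is a *Bayesian inverse* of $(F,\omega,\xi)$ if $\xi(G(a)b)=\omega(aF(b))$ and $\xi(bG(a))=\omega(F(b)a)$ for all $a\in\mathcal A$, $b\in\mathcal B$; it is a *disintegration* of $(F,\omega,\xi)$ if $\xi\circ G=\omega$ and $G\circ F$ is $\xi$-a.e. equivalent to $\mathrm{id}_{\mathcal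 B}$. (In each of these pairs of left and right conditions, the two are equivalent for the maps considered here.) Then the following hold. 1. Any two CPU Bayesian inverses of $(F,\omega,\xi)$ are $\xi$-a.e. equivalent. 2. If $G$ is a CPU Bayesian inverse of $(F,\omega,\xi)$, then $F$ is $\omega$-a.e. deterministic if and only if $G$ is a disintegration of $(F,\omega,\xi)$. 3. If $G$ is a CPU disintegration of $(F,\omega,\xi)$, then $F$ is $\omega$-a.e. deterministic and $G$ is a Bayesian inverse of $(F,\omega,\xi)$. 4. If $F$ is $\omega$-a.e. deterministic, then a CPU Bayesian inverse of $(F,\omega,\xi)$ exists if and only if a CPU disintegration exists. 5. Any two CPU disintegrations of $(F,\omega,\xi)$ are $\xi$-a.e. equivalent. 6. If $\mathcal A$ is commutative and $F$ is $\omega$-a.e. deterministic, then a CPU disintegration of $(F,\omega,\xi)$ exists. Neither hypothesis can be dropped: there are $\mathcal A,\mathcal B,\omega,F$ as above with $\mathcal A$ not commutative and $F$ $\omega$-a.e. deterministic for which no CPU disintegration exists, and there are such data with $\mathcal A$ commutative and $F$ not $\omega$-a.e. deterministic for which no CPU disintegration exists. 7. If $\mathcal A$ and $\mathcal B$ are commutative,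 then a CPU Bayesian inverse of $(F,\omega,\xi)$ exists. In each of the three cases ($\mathcal A$ not commutative and $\mathcal B$ commutative; $\mathcal A$ commutative and $\mathcal B$ not commutative; both not commutative) there are data $\mathcal A,\mathcal B,\omega,F$ as above for which no CPU Bayesian inverse exists. -/

import Mathlib

open scoped ComplexOrder CStarAlgebra

universe u v

/-- A state on a unital C⋆-algebra: a positive unital linear functional. -/
structure AlgState (A : Type*) [CStarAlgebra A] [PartialOrder A] [StarOrderedRing A]
    extends A →ₚ[ℂ] ℂ where
  map_one' : toFun 1 = 1

/-- A completely positive unital (CPU) map between unital C⋆-algebras. -/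
structure CPUMap (B A : Type*) [CStarAlgebra B] [PartialOrder B] [StarOrderedRing B]
    [CStarAlgebra A] [PartialOrder A] [StarOrderedRing A]
    extends B →CP A where
  map_one' : toFun 1 = 1

section

variable {A B : Type*} [CStarAlgebra A] [PartialOrder A] [StarOrderedRing A]
  [CStarAlgebra B] [PartialOrder B] [StarOrderedRing B]

/-- The pulled-back state `ω ∘ F` on `B`. -/
noncomputable def AlgState.comp (ω : AlgState A) (F : CPUMap B A) : AlgState B where
  toLinearMap := ω.toLinearMap ∘ₗ F.toLinearMap
  monotone' := fun _ _ h =>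
    ω.monotone' (OrderHomClass.mono F.toCompletelyPositiveMap h)
  map_one' := (congrArg ω.toLinearMap F.map_one').trans ω.map_one'

/-- `F` and `G` agree left `ω`-a.e.: the functionals obtained from `ω ∘ μ ∘ (F ⊗ id)` and
`ω ∘ μ ∘ (G ⊗ id)` on `B ⊗ A` coincide, with `μ` the multiplication of `A`. -/
def LeftAEEq (ω : A →ₗ[ℂ] ℂ) (F G : B →ₗ[ℂ] A) : Prop :=
  ∀ (b : B) (a : A), ω (F b * a) = ω (G b * a)

/-- `F` and `G` agree right `ω`-a.e. -/
def RightAEEq (ω : A →ₗ[ℂ] ℂ) (F G : B →ₗ[ℂ] A) : Prop :=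
  ∀ (b : B) (a : A), ω (a * F b) = ω (a * G b)

/-- `ω`-a.e. equivalence: both left and right a.e. equivalence. -/
def AEEq (ω : A →ₗ[ℂ] ℂ) (F G : B →ₗ[ℂ] A) : Prop :=
  LeftAEEq ω F G ∧ RightAEEq ω F G

/-- `F` is left `ω`-a.e. deterministic. -/
def LeftAEDeterministic (ω : A →ₗ[ℂ] ℂ) (F : B →ₗ[ℂ] A) : Prop :=
  ∀ (b c : B) (a : A), ω (F b * F c * a) = ω (F (b * c) * a)

/-- `F` is right `ω`-a.e. deterministic. -/
def RightAEDeterministic (ω : A →ₗ[ℂ] ℂ) (F : B →ₗ[ℂ] A) : Prop :=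
  ∀ (b c : B) (a : A), ω (a * (F b * F c)) = ω (a * F (b * c))

/-- `F` is `ω`-a.e. deterministic (on both sides; the two sides are equivalent for
star-preserving `ω` and `F`). -/
def AEDeterministic (ω : A →ₗ[ℂ] ℂ) (F : B →ₗ[ℂ] A) : Prop :=
  LeftAEDeterministic ω F ∧ RightAEDeterministic ω F

/-- `G` satisfies the left Bayes condition for `(F, ω, ξ)`. -/
def LeftBayes (F : B →ₗ[ℂ] A) (ω : A →ₗ[ℂ] ℂ) (ξ : B →ₗ[ℂ] ℂ) (G : A →ₗ[ℂ] B) : Prop :=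
  ∀ (a : A) (b : B), ξ (G a * b) = ω (a * F b)

/-- `G` satisfies the right Bayes condition for `(F, ω, ξ)`. -/
def RightBayes (F : B →ₗ[ℂ] A) (ω : A →ₗ[ℂ] ℂ) (ξ : B →ₗ[ℂ] ℂ) (G : A →ₗ[ℂ] B) : Prop :=
  ∀ (a : A) (b : B), ξ (b * G a) = ω (F b * a)

/-- The CPU map `G` is a Bayesian inverse of `(F, ω, ξ)` (on both sides; the two sides are
equivalent for star-preserving maps). -/
def IsBayesianInverse (F : CPUMap B A) (ω : AlgState A) (ξ : AlgState B)
    (G : CPUMap A B) : Prop :=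
  LeftBayes F.toLinearMap ω.toLinearMap ξ.toLinearMap G.toLinearMap ∧
    RightBayes F.toLinearMap ω.toLinearMap ξ.toLinearMap G.toLinearMap

/-- The CPU map `G` is a disintegration of `(F, ω, ξ)`: it pulls `ξ` back to `ω`, and `G ∘ F`
is `ξ`-a.e. equivalent to the identity of `B`. -/
def IsDisintegration (F : CPUMap B A) (ω : AlgState A) (ξ : AlgState B)
    (G : CPUMap A B) : Prop :=
  ξ.toLinearMap ∘ₗ G.toLinearMap = ω.toLinearMap ∧
    AEEq ξ.toLinearMap (G.toLinearMap ∘ₗ F.toLinearMap) LinearMap.id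

end

/-! The comparison of the two notions rests on equality in the Kadison–Schwarz inequality. For a
disintegration, ξ(b⋆b) = ω(F(b⋆b)) ≥ ω(F(b)⋆F(b)) = ξ(G(F(b)⋆F(b))) ≥ ξ(G(F(b))⋆G(F(b))) = ξ(b⋆b),
so both inequalities are equalities. By `CPUMap.map_mul_of_schwarz_eq` the first makes F a.e.
deterministic and the second gives the Bayes condition for G. Uniqueness of disintegrations thus
reduces to that of Bayesian inverses, where F and ω prescribe the functionals outright.

Existence is Bayes' formula on characters. A commutative A is spanned by positive elements dual to
its characters χ, and ω becomes a family of weights on them. Each χ ∘ F of nonzero weight is a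
nonnegative combination of characters of B: a single one if F is a.e. deterministic, several if B is
commutative. Conditional probabilities then define G (`exists_isBayesianInverse_of_characters`).

In the counterexamples with A noncommutative, ξ is tracial, so the two Bayes conditions would force
ω(aF(b)) = ω(F(b)a). With A commutative, the left condition alone forces G(1, 0) to be a matrix that
is not self-adjoint. -/

theorem exists_eq_star_mul_self {A : Type*} [NonUnitalCStarAlgebra A] [PartialOrder A]
    [StarOrderedRing A] {a : A} (ha : 0 ≤ a) : ∃ x : A, a = star x * x :=
  CStarAlgebra.nonneg_iff_eq_star_mul_self.mp ha

/-! ### Kadison–Schwarz and its equality case -/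

section

variable {A B : Type*} [CStarAlgebra A] [PartialOrder A] [StarOrderedRing A]
  [CStarAlgebra B] [PartialOrder B] [StarOrderedRing B]

theorem CPUMap.apply_star (F : CPUMap B A) (b : B) :
    F.toLinearMap (star b) = star (F.toLinearMap b) :=
  map_star F.toCompletelyPositiveMap b

theorem AlgState.apply_star (ω : AlgState A) (a : A) :
    ω.toLinearMap (star a) = star (ω.toLinearMap a) :=
  map_star ω.toPositiveLinearMap a

theorem AlgState.apply_nonneg (ω : AlgState A) {a : A} (ha : 0 ≤ a) : 0 ≤ ω.toLinearMap a :=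
  map_nonneg ω.toPositiveLinearMap ha

theorem CPUMap.apply_nonneg (F : CPUMap B A) {b : B} (hb : 0 ≤ b) : 0 ≤ F.toLinearMap b :=
  map_nonneg F.toCompletelyPositiveMap hb

theorem CPUMap.sum_kernel_nonneg {n : ℕ} [NeZero n] (F : CPUMap B A) (b : Fin n → B)
    (a : Fin n → A) :
    0 ≤ ∑ i, ∑ j, star (a i) * F.toLinearMap (star (b i) * b j) * a j := by
  -- With `b` as its only nonzero row, `R` satisfies (R⋆R) i j = (b i)⋆ (b j).
  let R : CStarMatrix (Fin n) (Fin n) B :=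
    CStarMatrix.ofMatrix fun i j => if i = 0 then b j else 0
  have hR (k i) : R k i = if k = 0 then b i else 0 := rfl
  have h1 : 0 ≤ (star R * R).map F.toLinearMap :=
    F.map_cstarMatrix_nonneg' _ _ (star_mul_self_nonneg R)
  obtain ⟨X, hX⟩ := exists_eq_star_mul_self h1
  have h2 (i j) : F.toLinearMap (star (b i) * b j) = ∑ k, star (X k i) * X k j := by
    have := congrArg (fun M : CStarMatrix (Fin n) (Fin n) A => M i j) hX
    simpa [CStarMatrix.mul_apply, CStarMatrix.star_apply, hR, apply_ite star, ite_mul] using this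
  have h3 : ∑ i, ∑ j, star (a i) * F.toLinearMap (star (b i) * b j) * a j =
      ∑ k, star (∑ i, X k i * a i) * (∑ i, X k i * a i) := by
    simp only [h2, star_sum, star_mul, Finset.mul_sum, Finset.sum_mul]
    rw [Finset.sum_comm]
    conv_rhs => rw [Finset.sum_comm]
    conv_rhs => enter [2, i]; rw [Finset.sum_comm]
    simp only [mul_assoc]
  rw [h3]
  exact Finset.sum_nonneg fun k _ => star_mul_self_nonneg _

/-- The defect of multiplicativity of a completely positive unital map is a positive kernel. -/
theorem CPUMap.defect_nonneg (F : CPUMap B A) (b c : B) (x a : A) :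
    0 ≤ star x * (F.toLinearMap (star b * b) - star (F.toLinearMap b) * F.toLinearMap b) * x
      + star x * (F.toLinearMap (star b * c) - star (F.toLinearMap b) * F.toLinearMap c) * a
      + star a * (F.toLinearMap (star c * b) - star (F.toLinearMap c) * F.toLinearMap b) * x
      + star a * (F.toLinearMap (star c * c) - star (F.toLinearMap c) * F.toLinearMap c) * a := by
  -- Completing the square: this coefficient of `1` minimises the form, leaving the Schur
  -- complement.
  have h := F.sum_kernel_nonneg ![1, b, c]
    ![-(F.toLinearMap b * x + F.toLinearMap c * a), x, a]
  have h1 : F.toLinearMap 1 = 1 := F.map_one'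
  simp only [Fin.sum_univ_three, Matrix.cons_val_zero, Matrix.cons_val_one, Matrix.cons_val,
    star_one, mul_one, one_mul, h1, F.apply_star, star_neg, star_add, star_mul] at h
  convert h using 1
  noncomm_ring

theorem CPUMap.schwarz (F : CPUMap B A) (b : B) :
    0 ≤ F.toLinearMap (star b * b) - star (F.toLinearMap b) * F.toLinearMap b := by
  simpa using F.defect_nonneg b 0 1 0

/-- Cauchy–Schwarz for the defect kernel: with x = t·1 the |t|² term vanishes by hypothesis, so
nonnegativity for all t kills the linear coefficient. -/
theorem CPUMap.map_mul_of_schwarz_eq (F : CPUMap B A) (ω : AlgState A) (b : B)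
    (hb : ω.toLinearMap (F.toLinearMap (star b * b)) =
      ω.toLinearMap (star (F.toLinearMap b) * F.toLinearMap b)) (c : B) (a : A) :
    ω.toLinearMap (star (F.toLinearMap b) * F.toLinearMap c * a) =
      ω.toLinearMap (F.toLinearMap (star b * c) * a) := by
  set z := ω.toLinearMap
    ((F.toLinearMap (star b * c) - star (F.toLinearMap b) * F.toLinearMap c) * a) with hz
  set w := ω.toLinearMap
    (star a * (F.toLinearMap (star c * c) - star (F.toLinearMap c) * F.toLinearMap c) * a) with hw
  have hz' : ω.toLinearMap
      (star a * (F.toLinearMap (star c * b) - star (F.toLinearMap c) * F.toLinearMap b)) =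
      star z := by
    rw [hz, ← ω.apply_star]
    simp [← F.apply_star]
  have key (t : ℂ) : 0 ≤ star t * z + t * star z + w := by
    have h := ω.apply_nonneg (F.defect_nonneg b c (t • 1) a)
    simp only [star_smul, star_one, smul_mul_assoc, one_mul, mul_smul_comm, mul_one, map_add,
      map_smul, map_sub, hb, sub_self, smul_eq_mul, mul_zero, zero_add] at h
    simpa only [← map_sub, ← hz, ← hw, hz', ← map_add] using h
  have hz0 : z = 0 := by
    by_contra hne
    have hpos : 0 < Complex.normSq z := Complex.normSq_pos.mpr hne
    -- This t gives the value -2(w + 1) + w < 0, since t = 0 gives w ≥ 0.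
    have h := key (-(((w.re + 1) / Complex.normSq z : ℝ) : ℂ) * z)
    have h' := (Complex.le_def.mp h).1
    have e1 : star (-(((w.re + 1) / Complex.normSq z : ℝ) : ℂ) * z) * z
        + (-(((w.re + 1) / Complex.normSq z : ℝ) : ℂ) * z) * star z
        = ((-2 * ((w.re + 1) / Complex.normSq z) * Complex.normSq z : ℝ) : ℂ) := by
      push_cast
      rw [Complex.normSq_eq_conj_mul_self]
      simp
      ring
    rw [e1, Complex.add_re, Complex.ofReal_re, mul_assoc, div_mul_cancel₀ _ hpos.ne'] at h'
    have h0 := (Complex.le_def.mp (key 0)).1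
    simp at h0 h'
    linarith
  rw [hz, sub_mul, map_sub, sub_eq_zero] at hz0
  exact hz0.symm

end

/-! ### Bayesian inverses versus disintegrations -/

section

variable {A B : Type*} [CStarAlgebra A] [PartialOrder A] [StarOrderedRing A]
  [CStarAlgebra B] [PartialOrder B] [StarOrderedRing B]

theorem IsBayesianInverse.aeEq {F : CPUMap B A} {ω : AlgState A} {ξ : AlgState B}
    {G G' : CPUMap A B} (h : IsBayesianInverse F ω ξ G) (h' : IsBayesianInverse F ω ξ G') :
    AEEq ξ.toLinearMap G.toLinearMap G'.toLinearMap :=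
  ⟨fun a b => (h.1 a b).trans (h'.1 a b).symm, fun a b => (h.2 a b).trans (h'.2 a b).symm⟩

theorem IsBayesianInverse.isDisintegration {F : CPUMap B A} {ω : AlgState A} {ξ : AlgState B}
    {G : CPUMap A B} (hξ : ξ = ω.comp F) (h : IsBayesianInverse F ω ξ G)
    (hF : AEDeterministic ω.toLinearMap F.toLinearMap) : IsDisintegration F ω ξ G := by
  have h1 : F.toLinearMap 1 = 1 := F.map_one'
  have hξF (b : B) : ξ.toLinearMap b = ω.toLinearMap (F.toLinearMap b) := by rw [hξ]; rfl
  refine ⟨LinearMap.ext fun a => ?_, fun b c => ?_, fun b c => ?_⟩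
  · simpa [h1] using h.1 a 1
  · have := hF.1 b c 1
    rw [mul_one, mul_one] at this
    exact (h.1 _ c).trans (this.trans (hξF _).symm)
  · have := hF.1 c b 1
    rw [mul_one, mul_one] at this
    exact (h.2 _ c).trans (this.trans (hξF _).symm)

theorem aeDeterministic_of_left {F : CPUMap B A} {ω : AlgState A}
    (h : LeftAEDeterministic ω.toLinearMap F.toLinearMap) :
    AEDeterministic ω.toLinearMap F.toLinearMap := by
  refine ⟨h, fun b c a => ?_⟩
  have := congrArg star (h (star c) (star b) (star a))
  simpa only [← ω.apply_star, ← F.apply_star, star_mul, star_star, mul_assoc] using this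

theorem isBayesianInverse_of_left {F : CPUMap B A} {ω : AlgState A} {ξ : AlgState B}
    {G : CPUMap A B} (h : LeftBayes F.toLinearMap ω.toLinearMap ξ.toLinearMap G.toLinearMap) :
    IsBayesianInverse F ω ξ G := by
  refine ⟨h, fun a b => ?_⟩
  have := congrArg star (h (star a) (star b))
  simpa only [← ω.apply_star, ← ξ.apply_star, ← F.apply_star, ← G.apply_star, star_mul,
    star_star] using this

theorem IsDisintegration.schwarz_eq {F : CPUMap B A} {ω : AlgState A} {ξ : AlgState B}
    {G : CPUMap A B} (hξ : ξ = ω.comp F) (h : IsDisintegration F ω ξ G) (b : B) :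
    ω.toLinearMap (F.toLinearMap (star b * b)) =
        ω.toLinearMap (star (F.toLinearMap b) * F.toLinearMap b) ∧
      ξ.toLinearMap (G.toLinearMap (star (F.toLinearMap b) * F.toLinearMap b)) =
        ξ.toLinearMap (star (G.toLinearMap (F.toLinearMap b)) * G.toLinearMap (F.toLinearMap b))
    := by
  have hξF (b : B) : ξ.toLinearMap b = ω.toLinearMap (F.toLinearMap b) := by rw [hξ]; rfl
  have hG (a : A) : ξ.toLinearMap (G.toLinearMap a) = ω.toLinearMap a :=
    congrArg (fun f : A →ₗ[ℂ] ℂ => f a) h.1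
  have h1 := ω.apply_nonneg (F.schwarz b)
  have h2 := ξ.apply_nonneg (G.schwarz (F.toLinearMap b))
  have h3 : ξ.toLinearMap
      (star (G.toLinearMap (F.toLinearMap b)) * G.toLinearMap (F.toLinearMap b)) =
        ω.toLinearMap (F.toLinearMap (star b * b)) := by
    -- Left a.e. equality removes G ∘ F from one factor, right a.e. equality from the other.
    rw [← hξF, ← G.apply_star, ← F.apply_star]
    exact (h.2.1 (star b) _).trans (h.2.2 b (star b))
  rw [map_sub, sub_nonneg] at h1 h2
  rw [h3, hG] at h2 ⊢
  exact ⟨le_antisymm h2 h1, le_antisymm h1 h2⟩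

theorem IsDisintegration.aeDeterministic {F : CPUMap B A} {ω : AlgState A} {ξ : AlgState B}
    {G : CPUMap A B} (hξ : ξ = ω.comp F) (h : IsDisintegration F ω ξ G) :
    AEDeterministic ω.toLinearMap F.toLinearMap := by
  refine aeDeterministic_of_left fun b c a => ?_
  simpa only [F.apply_star, star_star] using
    F.map_mul_of_schwarz_eq ω (star b) (h.schwarz_eq hξ _).1 c a

theorem IsDisintegration.isBayesianInverse {F : CPUMap B A} {ω : AlgState A} {ξ : AlgState B}
    {G : CPUMap A B} (hξ : ξ = ω.comp F) (h : IsDisintegration F ω ξ G) :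
    IsBayesianInverse F ω ξ G := by
  have hG (a : A) : ξ.toLinearMap (G.toLinearMap a) = ω.toLinearMap a :=
    congrArg (fun f : A →ₗ[ℂ] ℂ => f a) h.1
  refine isBayesianInverse_of_left fun a b => ?_
  -- After taking adjoints this reads ξ(G(a) G(F b)) = ξ(G(a F b)).
  have h1 := congrArg star (G.map_mul_of_schwarz_eq ξ _ (h.schwarz_eq hξ b).2 (star a) 1)
  simp only [← ξ.apply_star, ← F.apply_star, ← G.apply_star, star_mul, star_star, star_one,
    one_mul] at h1
  rw [← hG, ← h1]
  exact (h.2.2 b (G.toLinearMap a)).symm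

theorem IsDisintegration.aeEq {F : CPUMap B A} {ω : AlgState A} {ξ : AlgState B}
    {G G' : CPUMap A B} (hξ : ξ = ω.comp F) (h : IsDisintegration F ω ξ G)
    (h' : IsDisintegration F ω ξ G') : AEEq ξ.toLinearMap G.toLinearMap G'.toLinearMap :=
  (h.isBayesianInverse hξ).aeEq (h'.isBayesianInverse hξ)

end

/-! ### Characters and dual positive elements -/

section

/-- A functional killing the range is a linear relation among characters, hence zero by Dedekind's
independence. -/
theorem surjective_pi_algHom {R : Type*} [Ring R] [Algebra ℂ R] [Fintype (R →ₐ[ℂ] ℂ)] :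
    Function.Surjective (LinearMap.pi fun χ : R →ₐ[ℂ] ℂ => χ.toLinearMap) := by
  classical
  rw [← LinearMap.dualMap_injective_iff, ← LinearMap.ker_eq_bot, LinearMap.ker_eq_bot']
  intro φ hφ
  have hli := Fintype.linearIndependent_iff.mp (linearIndependent_toLinearMap ℂ R ℂ)
    (fun χ => φ fun i => if χ = i then 1 else 0) (by
      ext r
      have h := congrArg (fun f : Module.Dual ℂ R => f r) hφ
      rw [LinearMap.dualMap_apply, LinearMap.pi_apply_eq_sum_univ] at h
      simpa [mul_comm] using h)
  refine LinearMap.pi_ext' fun χ => LinearMap.ext_ring ?_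
  have hs : (Pi.single χ 1 : (R →ₐ[ℂ] ℂ) → ℂ) = fun i => if χ = i then 1 else 0 :=
    funext fun i => by simp [Pi.single_apply, eq_comm]
  simpa [hs] using hli χ

theorem finite_algHom {R : Type*} [Ring R] [Algebra ℂ R] [FiniteDimensional ℂ R] :
    Finite (R →ₐ[ℂ] ℂ) :=
  (linearIndependent_toLinearMap ℂ R ℂ).finite

/-- The tent function of half-width `1 / 2` centred at `c`. -/
noncomputable def tent (c t : ℝ) : ℝ := max 0 (1 - 2 * |t - c|)

theorem continuous_tent (c : ℝ) : Continuous (tent c) := by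
  unfold tent
  fun_prop

theorem tent_nonneg (c t : ℝ) : 0 ≤ tent c t := le_max_left _ _

theorem tent_le_one (c t : ℝ) : tent c t ≤ 1 :=
  max_le zero_le_one (by linarith [abs_nonneg (t - c)])

theorem tent_self (c : ℝ) : tent c c = 1 := by simp [tent]

theorem tent_eq_zero {c t : ℝ} (h : 1 / 2 ≤ |t - c|) : tent c t = 0 :=
  max_eq_left (by linarith)

theorem one_le_abs_natCast_sub {i j : ℕ} (h : i ≠ j) : (1 : ℝ) ≤ |(i : ℝ) - j| := by
  have : (1 : ℤ) ≤ |(i : ℤ) - j| := Int.one_le_abs (by omega)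
  exact_mod_cast this

theorem sum_tent_le_one {n : ℕ} (t : ℝ) : ∑ i : Fin n, tent (i : ℕ) t ≤ 1 := by
  by_cases h : ∃ i : Fin n, tent (i : ℕ) t ≠ 0
  · obtain ⟨i, hi⟩ := h
    rw [Finset.sum_eq_single i]
    · exact tent_le_one _ _
    · intro j _ hj
      by_contra hj0
      have h1 : |t - (i : ℕ)| < 1 / 2 := not_le.mp fun h => hi (tent_eq_zero h)
      have h2 : |t - (j : ℕ)| < 1 / 2 := not_le.mp fun h => hj0 (tent_eq_zero h)
      have h3 := one_le_abs_natCast_sub (Fin.val_injective.ne hj)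
      have h4 := abs_sub_le ((j : ℕ) : ℝ) t (i : ℕ)
      rw [abs_sub_comm _ t] at h4
      linarith
    · simp
  · push Not at h
    simp [h]

variable {B : Type*} [CStarAlgebra B] [PartialOrder B] [StarOrderedRing B]

theorem exists_selfAdjoint_separating [Fintype (B →ₐ[ℂ] ℂ)] (f : (B →ₐ[ℂ] ℂ) → ℝ) :
    ∃ h : B, IsSelfAdjoint h ∧ ∀ χ : B →ₐ[ℂ] ℂ, χ h = f χ := by
  obtain ⟨b, hb⟩ := surjective_pi_algHom (R := B) fun χ => (f χ : ℂ)
  have hb' (χ : B →ₐ[ℂ] ℂ) : χ b = f χ := congrFun hb χ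
  refine ⟨(1 / 2 : ℂ) • (b + star b), ?_, fun χ => ?_⟩
  · simp [isSelfAdjoint_iff, add_comm]
  · rw [map_smul, map_add, map_star, hb']
    simp
    ring

variable [FiniteDimensional ℂ B]

/-- Positive elements dual to the characters, with sum at most one. -/
theorem exists_dual_characters [Fintype (B →ₐ[ℂ] ℂ)] [DecidableEq (B →ₐ[ℂ] ℂ)] :
    ∃ e : (B →ₐ[ℂ] ℂ) → B, (∀ χ, 0 ≤ e χ) ∧ ∑ χ, e χ ≤ 1 ∧
      ∀ χ ψ : B →ₐ[ℂ] ℂ, ψ (e χ) = if ψ = χ then 1 else 0 := by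
  let ι := Fintype.equivFin (B →ₐ[ℂ] ℂ)
  -- Distinct characters take distinct integer values on `h`, so disjoint tents at these integers,
  -- applied to `h`, separate them.
  obtain ⟨h, hh, hχ⟩ := exists_selfAdjoint_separating (B := B) fun χ => ((ι χ : ℕ) : ℝ)
  refine ⟨fun χ => cfc (tent (ι χ : ℕ)) h, fun χ => cfc_nonneg fun t _ => tent_nonneg _ _,
    ?_, fun χ ψ => ?_⟩
  · rw [← cfc_sum _ h _ fun χ _ => (continuous_tent _).continuousOn]
    refine cfc_le_one _ _ fun t _ => ?_
    rw [Finset.sum_apply, ι.sum_comp fun i => tent (i : ℕ) t]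
    exact sum_tent_le_one t
  · have hc : Continuous ψ := ψ.toLinearMap.continuous_of_finiteDimensional
    rw [StarAlgHomClass.map_cfc (S := ℂ) ψ _ h (continuous_tent _).continuousOn hc hh
      (hh.map ψ), hχ, ← Complex.coe_algebraMap, cfc_algebraMap]
    split_ifs with hψ
    · simp [hψ, tent_self]
    · have := one_le_abs_natCast_sub (Fin.val_injective.ne (ι.injective.ne hψ))
      simp [tent_eq_zero (le_trans (by norm_num) this)]

theorem eq_zero_of_forall_character {A : Type*} [CommCStarAlgebra A] {a : A}
    (h : ∀ χ : A →ₐ[ℂ] ℂ, χ a = 0) : a = 0 := by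
  refine (gelfandTransform_isometry A).injective (ContinuousMap.ext fun χ => ?_)
  simpa using h (WeakDual.CharacterSpace.toAlgHom χ)

theorem sum_character_smul {A : Type*} [CStarAlgebra A] (hA : ∀ x y : A, x * y = y * x)
    [Fintype (A →ₐ[ℂ] ℂ)] [DecidableEq (A →ₐ[ℂ] ℂ)] {e : (A →ₐ[ℂ] ℂ) → A}
    (he : ∀ χ ψ : A →ₐ[ℂ] ℂ, ψ (e χ) = if ψ = χ then 1 else 0) (a : A) :
    ∑ χ : A →ₐ[ℂ] ℂ, χ a • e χ = a := by
  let _ : CommCStarAlgebra A := { ‹CStarAlgebra A› with mul_comm := hA }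
  refine sub_eq_zero.mp (eq_zero_of_forall_character fun ψ => ?_)
  simp [he]

end

/-! ### Existence by Bayes' formula -/

section

variable {A B : Type*} [CStarAlgebra A] [PartialOrder A] [StarOrderedRing A]
  [CStarAlgebra B] [PartialOrder B] [StarOrderedRing B]

/-- A unital linear map whose kernel `F (x⋆ y)` is a sum of squares is completely positive. -/
def CPUMap.ofKernel {ι : Type*} [Fintype ι] (F : B →ₗ[ℂ] A) (h1 : F 1 = 1) (s : ι → B → A)
    (hs : ∀ x y, F (star x * y) = ∑ l, star (s l x) * s l y) : CPUMap B A where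
  toLinearMap := F
  map_one' := h1
  map_cstarMatrix_nonneg' k M hM := by
    obtain ⟨X, rfl⟩ := exists_eq_star_mul_self hM
    have h : (star X * X).map F = ∑ l, star (X.map (s l)) * X.map (s l) := by
      ext i j
      have (S : ι → CStarMatrix (Fin k) (Fin k) A) : (∑ l, S l) i j = ∑ l, S l i j :=
        Matrix.sum_apply i j Finset.univ S
      rw [this]
      simp only [CStarMatrix.map_apply, CStarMatrix.mul_apply, CStarMatrix.star_apply, map_sum, hs]
      exact Finset.sum_comm
    rw [h]
    exact Finset.sum_nonneg fun l _ => star_mul_self_nonneg _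

variable [FiniteDimensional ℂ B]

/-- `hF` concerns only characters of nonzero weight, because a.e. determinism says nothing about the
others. -/
theorem exists_isBayesianInverse_of_characters (hA : ∀ x y : A, x * y = y * x)
    [Fintype (A →ₐ[ℂ] ℂ)] [DecidableEq (A →ₐ[ℂ] ℂ)]
    [Fintype (B →ₐ[ℂ] ℂ)] [DecidableEq (B →ₐ[ℂ] ℂ)]
    (F : CPUMap B A) (ω : AlgState A) {e : (A →ₐ[ℂ] ℂ) → A} (he0 : ∀ χ, 0 ≤ e χ)
    (he : ∀ χ ψ : A →ₐ[ℂ] ℂ, ψ (e χ) = if ψ = χ then 1 else 0)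
    (hF : ∀ χ : A →ₐ[ℂ] ℂ, ω.toLinearMap (e χ) ≠ 0 → ∃ w : (B →ₐ[ℂ] ℂ) → ℂ,
      (∀ ψ, 0 ≤ w ψ) ∧ ∀ b, χ (F.toLinearMap b) = ∑ ψ : B →ₐ[ℂ] ℂ, w ψ * ψ b) :
    ∃ G : CPUMap A B, IsBayesianInverse F ω (ω.comp F) G := by
  set p : (A →ₐ[ℂ] ℂ) → ℂ := fun χ => ω.toLinearMap (e χ) with hp
  have hp0 (χ) : 0 ≤ p χ := ω.apply_nonneg (he0 χ)
  have hω (a : A) : ω.toLinearMap a = ∑ χ : A →ₐ[ℂ] ℂ, χ a * p χ := by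
    conv_lhs => rw [← sum_character_smul hA he a]
    simp [hp]
  have hω1 : ω.toLinearMap 1 = 1 := ω.map_one'
  have hp1 : ∑ χ, p χ = 1 := by
    rw [hω] at hω1
    simpa using hω1
  have hw' : ∀ χ : A →ₐ[ℂ] ℂ, ∃ w : (B →ₐ[ℂ] ℂ) → ℂ,
      (∀ ψ, 0 ≤ w ψ) ∧ ∀ b, p χ * χ (F.toLinearMap b) = ∑ ψ : B →ₐ[ℂ] ℂ, w ψ * ψ b := by
    intro χ
    by_cases h : p χ = 0
    · exact ⟨0, fun _ => le_rfl, fun b => by simp [h]⟩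
    · obtain ⟨w, hw0, hw⟩ := hF χ h
      exact ⟨fun ψ => p χ * w ψ, fun ψ => mul_nonneg (hp0 χ) (hw0 ψ), fun b => by
        rw [hw, Finset.mul_sum]; simp only [mul_assoc]⟩
  choose w hw0 hw using hw'
  set q : (B →ₐ[ℂ] ℂ) → ℂ := fun ψ => ∑ χ, w χ ψ with hq
  have hq0 (ψ) : 0 ≤ q ψ := Finset.sum_nonneg fun χ _ => hw0 χ ψ
  have hξ (b : B) : (ω.comp F).toLinearMap b = ∑ ψ : B →ₐ[ℂ] ℂ, q ψ * ψ b := by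
    change ω.toLinearMap (F.toLinearMap b) = _
    simp only [hω, hq, Finset.sum_mul]
    rw [Finset.sum_comm]
    exact Finset.sum_congr rfl fun χ _ => by rw [mul_comm, hw]
  -- The conditional probability of χ given ψ. On null ψ any probability vector would do; `p` is one
  -- at hand.
  set v : (A →ₐ[ℂ] ℂ) → (B →ₐ[ℂ] ℂ) → ℂ := fun χ ψ => if q ψ = 0 then p χ else w χ ψ / q ψ
    with hv
  have hv0 (χ ψ) : 0 ≤ v χ ψ := by
    simp only [hv]
    split_ifs
    · exact hp0 χ
    · exact div_nonneg (hw0 χ ψ) (hq0 ψ)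
  have hv1 (ψ) : ∑ χ, v χ ψ = 1 := by
    by_cases h : q ψ = 0
    · simpa [hv, h] using hp1
    · simp only [hv, h, if_false, ← Finset.sum_div]
      exact div_self h
  have hqv (χ ψ) : q ψ * v χ ψ = w χ ψ := by
    by_cases h : q ψ = 0
    · have := (Finset.sum_eq_zero_iff_of_nonneg fun χ _ => hw0 χ ψ).mp h χ (Finset.mem_univ χ)
      rw [h, this, zero_mul]
    · simp only [hv, h, if_false]
      exact mul_div_cancel₀ _ h
  obtain ⟨f, hf0, hf1, hf⟩ := exists_dual_characters (B := B)
  -- For noncommutative B the `f ψ` may sum to less than 1. The remainder is killed by every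
  -- character; sharing it out by `p` makes the `c χ` sum to 1.
  set c : (A →ₐ[ℂ] ℂ) → B := fun χ => ∑ ψ, v χ ψ • f ψ + p χ • (1 - ∑ ψ, f ψ) with hc
  have hc0 (χ) : 0 ≤ c χ :=
    add_nonneg (Finset.sum_nonneg fun ψ _ => smul_nonneg (hv0 χ ψ) (hf0 ψ))
      (smul_nonneg (hp0 χ) (sub_nonneg.mpr hf1))
  have hc1 : ∑ χ, c χ = 1 := by
    simp only [hc, Finset.sum_add_distrib, ← Finset.sum_smul, hp1, one_smul]
    rw [Finset.sum_comm]
    simp [← Finset.sum_smul, hv1]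
  have hψc (χ) (ψ : B →ₐ[ℂ] ℂ) : ψ (c χ) = v χ ψ := by simp [hc, hf]
  choose r hr using fun χ => exists_eq_star_mul_self (hc0 χ)
  let G : A →ₗ[ℂ] B := ∑ χ : A →ₐ[ℂ] ℂ, χ.toLinearMap.smulRight (c χ)
  have hG (a : A) : G a = ∑ χ : A →ₐ[ℂ] ℂ, χ a • c χ := by simp [G]
  refine ⟨CPUMap.ofKernel G (by simpa [hG] using hc1) (fun χ a => χ a • r χ) fun x y => ?_,
    isBayesianInverse_of_left fun a b => ?_⟩
  · rw [hG]
    refine Finset.sum_congr rfl fun χ _ => ?_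
    rw [map_mul, map_star, star_smul, smul_mul_smul_comm, ← hr]
  · change (ω.comp F).toLinearMap (G a * b) = _
    rw [hG, Finset.sum_mul, map_sum, hω]
    refine Finset.sum_congr rfl fun χ _ => ?_
    rw [smul_mul_assoc, map_smul, hξ, map_mul, smul_eq_mul, mul_assoc, mul_comm _ (p χ), hw]
    congr 1
    refine Finset.sum_congr rfl fun ψ _ => ?_
    rw [map_mul, hψc, ← mul_assoc, hqv]

variable [FiniteDimensional ℂ A]

theorem exists_isBayesianInverse_of_aeDeterministic (hA : ∀ x y : A, x * y = y * x)
    (F : CPUMap B A) (ω : AlgState A) (hF : AEDeterministic ω.toLinearMap F.toLinearMap) :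
    ∃ G : CPUMap A B, IsBayesianInverse F ω (ω.comp F) G := by
  classical
  have := finite_algHom (R := A)
  have := Fintype.ofFinite (A →ₐ[ℂ] ℂ)
  have := finite_algHom (R := B)
  have := Fintype.ofFinite (B →ₐ[ℂ] ℂ)
  obtain ⟨e, he0, -, he⟩ := exists_dual_characters (B := A)
  refine exists_isBayesianInverse_of_characters hA F ω he0 he fun χ hχ => ?_
  have hmul (a : A) : ω.toLinearMap (a * e χ) = χ a * ω.toLinearMap (e χ) := by
    rw [← sum_character_smul hA he (a * e χ)]
    simp [he]
  -- Testing determinism against `e χ` evaluates it at χ, so χ ∘ F is multiplicative.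
  let φ : B →ₐ[ℂ] ℂ := AlgHom.ofLinearMap (χ.toLinearMap ∘ₗ F.toLinearMap)
    (by
      have h1 : F.toLinearMap 1 = 1 := F.map_one'
      simp [h1])
    (fun b c => by
      have h := hF.1 b c (e χ)
      rw [hmul, hmul] at h
      simpa using (mul_right_cancel₀ hχ h).symm)
  refine ⟨fun ψ => if ψ = φ then 1 else 0, fun ψ => ?_, fun b => ?_⟩
  · dsimp only
    split_ifs <;> simp
  · simp [φ]

theorem exists_isBayesianInverse_of_commutative (hA : ∀ x y : A, x * y = y * x)
    (hB : ∀ x y : B, x * y = y * x) (F : CPUMap B A) (ω : AlgState A) :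
    ∃ G : CPUMap A B, IsBayesianInverse F ω (ω.comp F) G := by
  classical
  have := finite_algHom (R := A)
  have := Fintype.ofFinite (A →ₐ[ℂ] ℂ)
  have := finite_algHom (R := B)
  have := Fintype.ofFinite (B →ₐ[ℂ] ℂ)
  obtain ⟨e, he0, -, he⟩ := exists_dual_characters (B := A)
  obtain ⟨f, hf0, -, hf⟩ := exists_dual_characters (B := B)
  refine exists_isBayesianInverse_of_characters hA F ω he0 he fun χ _ =>
    ⟨fun ψ => χ (F.toLinearMap (f ψ)), fun ψ => ?_, fun b => ?_⟩
  · obtain ⟨x, hx⟩ := exists_eq_star_mul_self (F.apply_nonneg (hf0 ψ))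
    simp only [hx, map_mul, map_star]
    exact star_mul_self_nonneg _
  · conv_lhs => rw [← sum_character_smul hB hf b]
    simp [mul_comm]

end

/-! ### Counterexamples -/

section

/-- A unital linear functional that is nonnegative on squares is a state. -/
def AlgState.ofSquares {A : Type*} [CStarAlgebra A] [PartialOrder A] [StarOrderedRing A]
    (φ : A →ₗ[ℂ] ℂ) (h1 : φ 1 = 1) (h : ∀ x, 0 ≤ φ (star x * x)) : AlgState A where
  toLinearMap := φ
  map_one' := h1
  monotone' x y hxy := by
    obtain ⟨z, hz⟩ := exists_eq_star_mul_self (sub_nonneg.mpr hxy)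
    have := h z
    rw [← hz, map_sub, sub_nonneg] at this
    exact this

/-- The C⋆-algebra of complex `2 × 2` matrices. -/
abbrev MatTwo := CStarMatrix (Fin 2) (Fin 2) ℂ

instance : FiniteDimensional ℂ MatTwo :=
  inferInstanceAs (FiniteDimensional ℂ (Matrix (Fin 2) (Fin 2) ℂ))

/-- The `2 × 2` matrix with the given rows. -/
def matTwo (a b c d : ℂ) : MatTwo := CStarMatrix.ofMatrix !![a, b; c, d]

theorem matTwo_apply (a b c d : ℂ) : matTwo a b c d 0 0 = a ∧ matTwo a b c d 0 1 = b ∧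
    matTwo a b c d 1 0 = c ∧ matTwo a b c d 1 1 = d := ⟨rfl, rfl, rfl, rfl⟩

theorem matTwo_mul_apply (x y : MatTwo) (i j : Fin 2) :
    (x * y) i j = x i 0 * y 0 j + x i 1 * y 1 j := by
  rw [CStarMatrix.mul_apply, Fin.sum_univ_two]

theorem matTwo_noncomm : ¬ ∀ x y : MatTwo, x * y = y * x := by
  intro h
  have := congrArg (fun m : MatTwo => m 0 0) (h (matTwo 0 1 0 0) (matTwo 0 0 1 0))
  simp [matTwo_mul_apply, matTwo_apply] at this

theorem star_mul_self_complex_nonneg (z : ℂ) : 0 ≤ star z * z := star_mul_self_nonneg z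

/-- The pure state of `(1, 1) / √2`. -/
noncomputable def plusState : AlgState MatTwo :=
  .ofSquares
    { toFun := fun a => (1 / 2) * (a 0 0 + a 0 1 + a 1 0 + a 1 1)
      map_add' := fun x y => by simp only [CStarMatrix.add_apply]; ring
      map_smul' := fun c x => by
        simp only [CStarMatrix.smul_apply, smul_eq_mul, RingHom.id_apply]; ring }
    (by
      change (1 / 2 : ℂ) * ((1 : MatTwo) 0 0 + (1 : MatTwo) 0 1 + (1 : MatTwo) 1 0
        + (1 : MatTwo) 1 1) = 1
      simp only [CStarMatrix.one_apply]
      norm_num)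
    (fun x => by
      change 0 ≤ (1 / 2 : ℂ) * ((star x * x) 0 0 + (star x * x) 0 1 + (star x * x) 1 0
        + (star x * x) 1 1)
      have h : (star x * x) 0 0 + (star x * x) 0 1 + (star x * x) 1 0 + (star x * x) 1 1 =
          star (x 0 0 + x 0 1) * (x 0 0 + x 0 1) + star (x 1 0 + x 1 1) * (x 1 0 + x 1 1) := by
        simp only [matTwo_mul_apply, CStarMatrix.star_apply, star_add]
        ring
      rw [h]
      exact mul_nonneg (div_nonneg zero_le_one zero_le_two)
        (add_nonneg (star_mul_self_complex_nonneg _) (star_mul_self_complex_nonneg _)))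

theorem plusState_apply (a : MatTwo) :
    plusState.toLinearMap a = (1 / 2) * (a 0 0 + a 0 1 + a 1 0 + a 1 1) := rfl

/-- The uniform state on `ℂ²`. -/
noncomputable def uniformState : AlgState (Fin 2 → ℂ) :=
  .ofSquares
    { toFun := fun a => (1 / 2) * (a 0 + a 1)
      map_add' := fun x y => by simp only [Pi.add_apply]; ring
      map_smul' := fun c x => by simp only [Pi.smul_apply, smul_eq_mul, RingHom.id_apply]; ring }
    (by
      change (1 / 2 : ℂ) * (1 + 1) = 1
      norm_num)
    (fun x => by
      change 0 ≤ (1 / 2 : ℂ) * (star (x 0) * x 0 + star (x 1) * x 1)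
      exact mul_nonneg (div_nonneg zero_le_one zero_le_two)
        (add_nonneg (star_mul_self_complex_nonneg _) (star_mul_self_complex_nonneg _)))

theorem uniformState_apply (a : Fin 2 → ℂ) :
    uniformState.toLinearMap a = (1 / 2) * (a 0 + a 1) := rfl

/-- The inclusion of `ℂ²` as the diagonal matrices. -/
def diagLinear : (Fin 2 → ℂ) →ₗ[ℂ] MatTwo where
  toFun b := matTwo (b 0) 0 0 (b 1)
  map_add' x y := by
    ext i j; fin_cases i <;> fin_cases j <;> simp [matTwo_apply]
  map_smul' c x := by
    ext i j; fin_cases i <;> fin_cases j <;> simp [matTwo_apply]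

theorem diagLinear_mul (x y : Fin 2 → ℂ) :
    diagLinear (x * y) = diagLinear x * diagLinear y := by
  ext i j
  fin_cases i <;> fin_cases j <;> simp [diagLinear, matTwo_mul_apply, matTwo_apply]

theorem diagLinear_one : diagLinear 1 = 1 := by
  ext i j
  fin_cases i <;> fin_cases j <;> simp [diagLinear, matTwo_apply]

theorem diagLinear_star (x : Fin 2 → ℂ) : diagLinear (star x) = star (diagLinear x) := by
  ext i j
  fin_cases i <;> fin_cases j <;> simp [diagLinear, matTwo_apply, CStarMatrix.star_apply]

/-- The diagonal inclusion as a completely positive map. -/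
noncomputable def diagMap : CPUMap (Fin 2 → ℂ) MatTwo :=
  .ofKernel diagLinear diagLinear_one (fun (_ : Unit) x => diagLinear x) fun x y => by
    simp [diagLinear_mul, diagLinear_star]

theorem diagMap_aeDeterministic (ω : AlgState MatTwo) :
    AEDeterministic ω.toLinearMap diagMap.toLinearMap :=
  aeDeterministic_of_left fun b c a => by
    change ω.toLinearMap (diagLinear b * diagLinear c * a) = ω.toLinearMap (diagLinear _ * a)
    rw [diagLinear_mul]

/-- B is commutative, yet ω(aF(b)) = 0 and ω(F(b)a) = 1/2 for a = E₁₂, F(b) = E₁₁. -/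
theorem diagMap_no_bayesianInverse :
    ¬ ∃ G, IsBayesianInverse diagMap plusState (plusState.comp diagMap) G := by
  rintro ⟨G, h⟩
  have h1 := h.1 (matTwo 0 1 0 0) ![1, 0]
  have h2 := h.2 (matTwo 0 1 0 0) ![1, 0]
  rw [mul_comm, h1] at h2
  change plusState.toLinearMap (_ * diagLinear _) = plusState.toLinearMap (diagLinear _ * _) at h2
  simp [plusState_apply, matTwo_mul_apply, diagLinear, matTwo_apply] at h2

/-- The restriction of a `2 × 2` matrix to its diagonal. -/
def pinchLinear : MatTwo →ₗ[ℂ] MatTwo :=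
  diagLinear ∘ₗ
    { toFun := fun b => ![b 0 0, b 1 1]
      map_add' := fun x y => by ext i; fin_cases i <;> simp
      map_smul' := fun c x => by ext i; fin_cases i <;> simp }

theorem pinchLinear_apply (b : MatTwo) : pinchLinear b = matTwo (b 0 0) 0 0 (b 1 1) := rfl

/-- The restriction to the diagonal as a completely positive map. -/
noncomputable def pinchMap : CPUMap MatTwo MatTwo :=
  .ofKernel pinchLinear
    (by rw [pinchLinear_apply, ← diagLinear_one]; simp [diagLinear, matTwo_apply])
    (fun l x => diagLinear (x l)) fun x y => by
      simp only [← diagLinear_star, ← diagLinear_mul, ← map_sum]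
      rw [pinchLinear_apply]
      simp [diagLinear, matTwo_mul_apply, CStarMatrix.star_apply]

/-- Here ξ is the normalised trace, so the obstruction of the diagonal inclusion persists. -/
theorem pinchMap_no_bayesianInverse :
    ¬ ∃ G, IsBayesianInverse pinchMap plusState (plusState.comp pinchMap) G := by
  rintro ⟨G, h⟩
  have hξ (b : MatTwo) : (plusState.comp pinchMap).toLinearMap b = (1 / 2) * (b 0 0 + b 1 1) := by
    change plusState.toLinearMap (pinchLinear b) = _
    simp [plusState_apply, pinchLinear_apply, matTwo_apply]
  have h1 := h.1 (matTwo 0 1 0 0) (matTwo 1 0 0 0)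
  have h2 := h.2 (matTwo 0 1 0 0) (matTwo 1 0 0 0)
  change _ = plusState.toLinearMap (_ * pinchLinear _) at h1
  change _ = plusState.toLinearMap (pinchLinear _ * _) at h2
  rw [hξ] at h1 h2
  simp [plusState_apply, matTwo_mul_apply, pinchLinear_apply, matTwo_apply] at h1 h2
  rw [h1] at h2
  simp at h2

/-- The pair of vector states of `(1, 0)` and `(1, 1) / √2`. -/
noncomputable def pairLinear : MatTwo →ₗ[ℂ] (Fin 2 → ℂ) where
  toFun b := ![b 0 0, (1 / 2) * (b 0 0 + b 0 1 + b 1 0 + b 1 1)]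
  map_add' x y := by ext i; fin_cases i <;> simp; ring
  map_smul' c x := by ext i; fin_cases i <;> simp; ring

/-- `pairLinear` as a completely positive map. -/
noncomputable def pairMap : CPUMap MatTwo (Fin 2 → ℂ) :=
  .ofKernel pairLinear
    (by ext i; fin_cases i <;> simp [pairLinear]; norm_num)
    -- The vector state of v satisfies φ(x⋆y) = ∑ conj((xv)ₗ) (yv)ₗ; the entries are (xv)ₗ for the
    -- two vectors.
    (fun l x => ![x l 0, ((√(1 / 2) : ℝ) : ℂ) * (x l 0 + x l 1)]) fun x y => by
      have hs : ((√(1 / 2) : ℝ) : ℂ) * ((√(1 / 2) : ℝ) : ℂ) = 1 / 2 := by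
        rw [← Complex.ofReal_mul, Real.mul_self_sqrt (by norm_num)]
        norm_num
      ext i
      fin_cases i
      · simp [pairLinear, matTwo_mul_apply, CStarMatrix.star_apply]
      · simp only [pairLinear, matTwo_mul_apply, CStarMatrix.star_apply, LinearMap.coe_mk,
          AddHom.coe_mk, Finset.sum_apply, Fin.sum_univ_two, Pi.mul_apply, Pi.star_apply,
          Fin.mk_one, Matrix.cons_val_one, Matrix.cons_val_fin_one,
          star_mul', star_add, Complex.star_def, Complex.conj_ofReal]
        linear_combination (-((starRingEnd ℂ (x 0 0) + starRingEnd ℂ (x 0 1)) * (y 0 0 + y 0 1)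
          + (starRingEnd ℂ (x 1 0) + starRingEnd ℂ (x 1 1)) * (y 1 0 + y 1 1))) * hs

theorem pairMap_no_bayesianInverse :
    ¬ ∃ G, IsBayesianInverse pairMap uniformState (uniformState.comp pairMap) G := by
  rintro ⟨G, h⟩
  have hξ (b : MatTwo) : (uniformState.comp pairMap).toLinearMap b =
      (1 / 2) * (b 0 0 + (1 / 2) * (b 0 0 + b 0 1 + b 1 0 + b 1 1)) := by
    change uniformState.toLinearMap (pairLinear b) = _
    simp [uniformState_apply, pairLinear]
  have hL (b : MatTwo) := h.1 ![1, 0] b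
  have hR (b : MatTwo) := h.2 ![1, 0] b
  have hF (b : MatTwo) : uniformState.toLinearMap (pairMap.toLinearMap b * ![1, 0]) =
      (1 / 2) * b 0 0 := by
    change uniformState.toLinearMap (pairLinear b * ![1, 0]) = _
    simp [uniformState_apply, pairLinear]
  have hF' (b : MatTwo) : uniformState.toLinearMap (![1, 0] * pairMap.toLinearMap b) =
      (1 / 2) * b 0 0 := by rw [mul_comm, hF]
  generalize G.toLinearMap ![1, 0] = g at hL hR
  have h1 := hL (matTwo 1 0 0 0)
  have h2 := hL (matTwo 0 1 0 0)
  have h3 := hL (matTwo 0 0 1 0)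
  have h4 := hR (matTwo 1 0 0 0)
  have h5 := hL (matTwo 0 0 0 1)
  rw [hξ, hF'] at h1 h2 h3 h5
  rw [hξ, hF] at h4
  simp only [matTwo_mul_apply, matTwo_apply] at h1 h2 h3 h4 h5
  -- The left conditions force g to have rows (1, 0) and (-1, 0); the right condition `h4` would
  -- then say 3/2 = 1.
  have : (0 : ℂ) = -1 := by
    linear_combination 4 * h4 - 6 * h1 + 6 * h2 - 2 * h3 + 2 * h5
  simp at this

end

theorem mainTheorem6 :
    -- the positive part
    (∀ (A : Type u) (B : Type v)
      [CStarAlgebra A] [PartialOrder A] [StarOrderedRing A] [FiniteDimensional ℂ A]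
      [CStarAlgebra B] [PartialOrder B] [StarOrderedRing B] [FiniteDimensional ℂ B]
      (ω : AlgState A) (F : CPUMap B A) (ξ : AlgState B), ξ = ω.comp F →
      -- Bayesian inverses are a.e. unique
      (∀ G G' : CPUMap A B, IsBayesianInverse F ω ξ G → IsBayesianInverse F ω ξ G' →
        AEEq ξ.toLinearMap G.toLinearMap G'.toLinearMap) ∧
      -- a Bayesian inverse is a disintegration iff `F` is a.e. deterministic
      (∀ G : CPUMap A B, IsBayesianInverse F ω ξ G →
        (AEDeterministic ω.toLinearMap F.toLinearMap ↔ IsDisintegration F ω ξ G)) ∧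
      -- a disintegration forces a.e. determinism and is a Bayesian inverse
      (∀ G : CPUMap A B, IsDisintegration F ω ξ G →
        AEDeterministic ω.toLinearMap F.toLinearMap ∧ IsBayesianInverse F ω ξ G) ∧
      -- for a.e. deterministic `F`, the two existence questions are equivalent
      (AEDeterministic ω.toLinearMap F.toLinearMap →
        ((∃ G : CPUMap A B, IsBayesianInverse F ω ξ G) ↔
          ∃ G : CPUMap A B, IsDisintegration F ω ξ G)) ∧
      -- disintegrations are a.e. unique
      (∀ G G' : CPUMap A B, IsDisintegration F ω ξ G → IsDisintegration F ω ξ G' →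
        AEEq ξ.toLinearMap G.toLinearMap G'.toLinearMap) ∧
      -- existence of disintegrations for commutative `A`
      ((∀ x y : A, x * y = y * x) → AEDeterministic ω.toLinearMap F.toLinearMap →
        ∃ G : CPUMap A B, IsDisintegration F ω ξ G) ∧
      -- existence of Bayesian inverses for commutative `A` and `B`
      ((∀ x y : A, x * y = y * x) → (∀ x y : B, x * y = y * x) →
        ∃ G : CPUMap A B, IsBayesianInverse F ω ξ G)) ∧
    -- no disintegration: `A` noncommutative, `F` a.e. deterministic
    (∃ (A B : Type)
      (_ : CStarAlgebra A) (_ : PartialOrder A) (_ : StarOrderedRing A)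
      (_ : FiniteDimensional ℂ A)
      (_ : CStarAlgebra B) (_ : PartialOrder B) (_ : StarOrderedRing B)
      (_ : FiniteDimensional ℂ B)
      (ω : AlgState A) (F : CPUMap B A),
      (¬ ∀ x y : A, x * y = y * x) ∧ AEDeterministic ω.toLinearMap F.toLinearMap ∧
        ¬ ∃ G : CPUMap A B, IsDisintegration F ω (ω.comp F) G) ∧
    -- no disintegration: `A` commutative, `F` not a.e. deterministic
    (∃ (A B : Type)
      (_ : CStarAlgebra A) (_ : PartialOrder A) (_ : StarOrderedRing A)
      (_ : FiniteDimensional ℂ A)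
      (_ : CStarAlgebra B) (_ : PartialOrder B) (_ : StarOrderedRing B)
      (_ : FiniteDimensional ℂ B)
      (ω : AlgState A) (F : CPUMap B A),
      (∀ x y : A, x * y = y * x) ∧ ¬ AEDeterministic ω.toLinearMap F.toLinearMap ∧
        ¬ ∃ G : CPUMap A B, IsDisintegration F ω (ω.comp F) G) ∧
    -- no Bayesian inverse: `A` noncommutative, `B` commutative
    (∃ (A B : Type)
      (_ : CStarAlgebra A) (_ : PartialOrder A) (_ : StarOrderedRing A)
      (_ : FiniteDimensional ℂ A)
      (_ : CStarAlgebra B) (_ : PartialOrder B) (_ : StarOrderedRing B)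
      (_ : FiniteDimensional ℂ B)
      (ω : AlgState A) (F : CPUMap B A),
      (¬ ∀ x y : A, x * y = y * x) ∧ (∀ x y : B, x * y = y * x) ∧
        ¬ ∃ G : CPUMap A B, IsBayesianInverse F ω (ω.comp F) G) ∧
    -- no Bayesian inverse: `A` commutative, `B` noncommutative
    (∃ (A B : Type)
      (_ : CStarAlgebra A) (_ : PartialOrder A) (_ : StarOrderedRing A)
      (_ : FiniteDimensional ℂ A)
      (_ : CStarAlgebra B) (_ : PartialOrder B) (_ : StarOrderedRing B)
      (_ : FiniteDimensional ℂ B)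
      (ω : AlgState A) (F : CPUMap B A),
      (∀ x y : A, x * y = y * x) ∧ (¬ ∀ x y : B, x * y = y * x) ∧
        ¬ ∃ G : CPUMap A B, IsBayesianInverse F ω (ω.comp F) G) ∧
    -- no Bayesian inverse: `A` and `B` both noncommutative
    (∃ (A B : Type)
      (_ : CStarAlgebra A) (_ : PartialOrder A) (_ : StarOrderedRing A)
      (_ : FiniteDimensional ℂ A)
      (_ : CStarAlgebra B) (_ : PartialOrder B) (_ : StarOrderedRing B)
      (_ : FiniteDimensional ℂ B)
      (ω : AlgState A) (F : CPUMap B A),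
      (¬ ∀ x y : A, x * y = y * x) ∧ (¬ ∀ x y : B, x * y = y * x) ∧
        ¬ ∃ G : CPUMap A B, IsBayesianInverse F ω (ω.comp F) G) := by
  refine ⟨?_, ?_, ?_, ?_, ?_, ?_⟩
  · intro A B _ _ _ _ _ _ _ _ ω F ξ hξ
    refine ⟨fun G G' h h' => h.aeEq h', fun G h => ⟨h.isDisintegration hξ,
      fun hd => hd.aeDeterministic hξ⟩, fun G h => ⟨h.aeDeterministic hξ,
      h.isBayesianInverse hξ⟩, fun hF => ⟨fun ⟨G, h⟩ => ⟨G, h.isDisintegration hξ hF⟩,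
      fun ⟨G, h⟩ => ⟨G, h.isBayesianInverse hξ⟩⟩, fun G G' h h' => h.aeEq hξ h',
      fun hA hF => ?_, fun hA hB => ?_⟩
    · obtain ⟨G, h⟩ := exists_isBayesianInverse_of_aeDeterministic hA F ω hF
      rw [← hξ] at h
      exact ⟨G, h.isDisintegration hξ hF⟩
    · rw [hξ]
      exact exists_isBayesianInverse_of_commutative hA hB F ω
  · exact ⟨MatTwo, Fin 2 → ℂ, inferInstance, inferInstance, inferInstance, inferInstance,
      inferInstance, inferInstance, inferInstance, inferInstance, plusState, diagMap,
      matTwo_noncomm, diagMap_aeDeterministic _, fun ⟨G, h⟩ =>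
        diagMap_no_bayesianInverse ⟨G, h.isBayesianInverse rfl⟩⟩
  · exact ⟨Fin 2 → ℂ, MatTwo, inferInstance, inferInstance, inferInstance, inferInstance,
      inferInstance, inferInstance, inferInstance, inferInstance, uniformState, pairMap,
      -- Determinism fails because, with A commutative, it would yield a Bayesian inverse.
      mul_comm, fun hF => pairMap_no_bayesianInverse
        (exists_isBayesianInverse_of_aeDeterministic mul_comm _ _ hF), fun ⟨G, h⟩ =>
        pairMap_no_bayesianInverse ⟨G, h.isBayesianInverse rfl⟩⟩
  · exact ⟨MatTwo, Fin 2 → ℂ, inferInstance, inferInstance, inferInstance, inferInstance,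
      inferInstance, inferInstance, inferInstance, inferInstance, plusState, diagMap,
      matTwo_noncomm, mul_comm, diagMap_no_bayesianInverse⟩
  · exact ⟨Fin 2 → ℂ, MatTwo, inferInstance, inferInstance, inferInstance, inferInstance,
      inferInstance, inferInstance, inferInstance, inferInstance, uniformState, pairMap,
      mul_comm, matTwo_noncomm, pairMap_no_bayesianInverse⟩
  · exact ⟨MatTwo, MatTwo, inferInstance, inferInstance, inferInstance, inferInstance,
      inferInstance, inferInstance, inferInstance, inferInstance, plusState, pinchMap,
      matTwo_noncomm, matTwo_noncomm, pinchMap_no_bayesianInverse⟩
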